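/- **Setting.** Let $n$ processes be partitioned into $m\ge 2$ nonempty clusters by $\mathsf{cluster}:\{1,\dots,n\}\to\{1,\dots,m\}$. Any two processes exchange messages over asynchronous reliable links, and the processes of a cluster share a read/write memory. In an algorithm $\mathcal A$, a step of a process uses a fresh private random coin (all coins are independent) and either performs one operation on the memory of its own cluster or receives one message; it changes the local state and may send messages. Each process may output a point of $\mathbb R^d$ (its first output counts). The adversary is weak: it fixes in advance the infinite sequence of steps and message deliveries, without observing coins, memories or messages. Such a sequence determines an execution tree $\mathcal T$ of $\mathcal A$, in which only the coins branch. A process *crashes* in $\mathcal T$ if it stops taking steps from some point on; $P(\mathcal T)$ is the set of the processes that do not crash (it is the same for all executions in $\mathcal T$). The processes in $P(\mathcal T)$ perform memory steps infinitely often, and for all $i\in P(\mathcal T)$, $j$ and $k$ the delivery to $i$ of the $k$-th message from $j$ is scheduled infinitely often (without effect if that message is not pending), so that every message sent to $i$ is eventually delivered. **Sequential SGD.** Let $Q(\mathbf x)=\mathbb E_{z\sim\mathcal D}\,\ell(\mathbf x,z)$ be differentiable with Lipschitz gradient, with stochastic gradients $G(\mathbf x,z)=\nabla_{\mathbf x}\ell(\mathbf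 x,z)$ that are unbiased estimators of $\nabla Q(\mathbf x)$ and have uniformly bounded variance. $\mathcal A^{seq}(Q,T,\mathbf x_0)$ iterates $\mathbf x_{t+1}=\mathbf x_t-\eta_t G(\mathbf x_t,z_t)$ for $T$ steps with i.i.d. $z_t\sim\mathcal D$, and outputs $\mathbf x_{seq}=\mathbf x_\tau$, where $\tau\in\{0,\dots,T\}$ is independent of the samples and has a given law (e.g. $\tau=T$). For $\beta>0$ and $S\subseteq\mathbb R^d$ let $E_{seq}(\beta,S)$ be the event that $\|\mathbf x_{seq}-\mathbf x\|_2\le\beta$ for some $\mathbf x\in S$. $Q$ is *$(\gamma,p)$-split*, for $\gamma>0$ and $p\in[0,1]$, if there are $S_1,S_2\subseteq\mathbb R^d$, $r\in\mathbb R$ and $\alpha,\beta>0$ such that $\|\mathbf x_1-\mathbf x_2\|_2\ge r$ for all $\mathbf x_1\in S_1$, $\mathbf x_2\in S_2$, such that $r-\alpha-\beta\ge\gamma$, and such that $\Pr[E_{seq}(\alpha,S_1)]\cdot\Pr[E_{seq}(\beta,S_2)]\ge p$. **Implementation.** Let $\varepsilon,\delta>0$. Random outputs $\mathbf x^i\in\mathbb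 R^d\cup\{\bot\}$ of the processes over $\mathcal T$ *implement* $\mathcal A^{seq}(Q,T,\mathbf x_0)$ if * (external convergence) $\mathbb E\|\nabla Q(\mathbf x^i)\|_2^2\le\varepsilon$ for all $i$; * (internal convergence) $\mathbb E\|\mathbf x^i-\mathbf x^j\|_2^2\le\delta$ for all $i,j$; * (preserving the convergence distribution) for all $\beta>0$, all $S\subseteq\mathbb R^d$ and all sets $P$ of processes that contain a process of $P(\mathcal T)$, the probability that $\|\mathbf x^i-\mathbf x\|_2\le\beta$ for some $\mathbf x\in S$ and some $i\in P$ with $\mathbf x^i\ne\bot$ is at least $\Pr[E_{seq}(\beta,S)]$. In the expectations, only executions in which the outputs concerned are not $\bot$ contribute. **Theorem.** Suppose that $Q$ is $(\gamma,p)$-split with $p>\delta n^2/\gamma^2$ and $\gamma\ge\sqrt\delta\,n$. Then: 1. There is no algorithm $\mathcal A$ whose outputs, with $\mathbf x^i=\bot$ if and only if process $i$ never outputs a value (in particular if it crashes before doing so), implement $\mathcal A^{seq}(Q,T,\mathbf x_0)$ over all execution trees $\mathcal T$ with $|\mathsf{cluster}(P(\mathcal T))|\le\lfloor m/2\rfloor$.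 2. There is no algorithm $\mathcal A$ whose outputs, with $\mathbf x^i=\bot$ also for every process $i$ that crashes at any time, implement $\mathcal A^{seq}(Q,T,\mathbf x_0)$ over all execution trees $\mathcal T$ with $|\mathsf{cluster}(P(\mathcal T))|\ge\lfloor m/2\rfloor$, i.e. no algorithm tolerates the crash of $\lceil m/2\rceil$ of the clusters, even if convergence is required only of the processes that never crash. -/

import Mathlib

open MeasureTheory ProbabilityTheory Filter
open scoped ENNReal

universe u v

noncomputable section

/-- The parameter space `ℝ^d` with its Euclidean norm. -/
abbrev Param (d : ℕ) : Type := EuclideanSpace ℝ (Fin d)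

/-! ### Sequential stochastic gradient descent -/

/-- The data of a sequential SGD algorithm: a data distribution, a loss function `ℓ(x, z)`,
learning rates, the number `T` of iterations, the initial point, and the law of the index (among
`0, …, T`) of the iterate that is output. The Dirac mass at `T` outputs the last iterate; the
uniform law outputs a uniformly random iterate. -/
structure SeqSGD (d : ℕ) where
  Data : Type v
  [dataMeas : MeasurableSpace Data]
  law : Measure Data
  [isProb : IsProbabilityMeasure law]
  loss : Param d → Data → ℝ
  rate : ℕ → ℝ
  T : ℕ
  start : Param d
  outIndex : PMF (Fin (T + 1))

attribute [instance] SeqSGD.dataMeas SeqSGD.isProb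

namespace SeqSGD

variable {d : ℕ} (M : SeqSGD.{v} d)

/-- The cost function `Q(x) = E_z ℓ(x, z)`. -/
def cost (x : Param d) : ℝ := ∫ z, M.loss x z ∂M.law

/-- The stochastic gradient `G(x, z) = ∇ₓ ℓ(x, z)`. -/
def stochGrad (x : Param d) (z : M.Data) : Param d := gradient (fun y => M.loss y z) x

/-- The standing assumptions on loss and cost: `Q` is differentiable and `L`-smooth, the
stochastic gradient is unbiased, with variance at most `s ^ 2`. -/
structure Regular (L s : ℝ) : Prop where
  loss_measurable : ∀ x, Measurable (M.loss x)
  loss_integrable : ∀ x, Integrable (M.loss x) M.law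
  loss_differentiable : ∀ z, Differentiable ℝ (fun x => M.loss x z)
  cost_differentiable : Differentiable ℝ M.cost
  L_pos : 0 < L
  smooth : ∀ x y, ‖gradient M.cost x - gradient M.cost y‖ ≤ L * ‖x - y‖
  grad_integrable : ∀ x, Integrable (M.stochGrad x) M.law
  unbiased : ∀ x, ∫ z, M.stochGrad x z ∂M.law = gradient M.cost x
  s_nonneg : 0 ≤ s
  variance_le : ∀ x,
    ∫⁻ z, ENNReal.ofReal (‖M.stochGrad x z - gradient M.cost x‖ ^ 2) ∂M.law ≤ ENNReal.ofReal (s ^ 2)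

/-- The SGD iterates `x_{t+1} = x_t - η_t G(x_t, z_t)` along a sequence of samples. -/
def iterate (z : ℕ → M.Data) : ℕ → Param d
  | 0 => M.start
  | t + 1 => iterate z t - M.rate t • M.stochGrad (iterate z t) (z t)

/-- The sample space: a sequence of data points and the index of the iterate to be output. -/
abbrev Sample : Type v := (ℕ → M.Data) × Fin (M.T + 1)

/-- The samples are i.i.d. and independent of the output index. -/
def prob : Measure M.Sample :=
  (Measure.infinitePi fun _ : ℕ => M.law).prod M.outIndex.toMeasure

/-- The output `x_seq` of the sequential algorithm. -/
def output (w : M.Sample) : Param d := M.iterate w.1 w.2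

/-- The event that `x_seq` is within distance `β` of some point of `S`. -/
def near (β : ℝ) (S : Set (Param d)) : Set M.Sample := {w | ∃ x ∈ S, ‖M.output w - x‖ ≤ β}

/-- `(γ, p)`-split. -/
def IsSplit (γ p : ℝ) : Prop :=
  0 < γ ∧ 0 ≤ p ∧ p ≤ 1 ∧
    ∃ (S₁ S₂ : Set (Param d)) (r α β : ℝ), 0 < α ∧ 0 < β ∧
      (∀ x₁ ∈ S₁, ∀ x₂ ∈ S₂, r ≤ ‖x₁ - x₂‖) ∧ γ ≤ r - α - β ∧
      p ≤ M.prob.real (M.near α S₁) * M.prob.real (M.near β S₂)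

end SeqSGD

/-! ### The cluster-based model -/

/-- An operation on the shared memory of a cluster (`skip`: a purely local step). -/
inductive MemOp (Reg Val : Type u) : Type u
  | skip
  | read (r : Reg)
  | write (r : Reg) (v : Val)

/-- A randomized algorithm for `n` asynchronous processes in `m` clusters, with outputs in `ℝ^d`.
Every step of a process uses a fresh local coin, whose values may form any probability space.
A step either performs one operation on the memory of the process's own cluster or receives one
message; it yields a new local state and, for each process, a list of messages sent to it. -/
structure ClusterAlg (n m d : ℕ) where
  State : Type u
  Msg : Type u
  Reg : Type u
  Val : Type u
  Coin : Type u
  [coinMeas : MeasurableSpace Coin]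
  coinLaw : Measure Coin
  [isProb : IsProbabilityMeasure coinLaw]
  init : Fin n → State
  memInit : Fin m → Reg → Val
  /-- the memory operation that a process performs -/
  memOp : Fin n → State → Coin → MemOp Reg Val
  /-- new state and sent messages after a memory operation, given the value read, if any -/
  afterOp : Fin n → State → Coin → Option Val → State × (Fin n → List Msg)
  /-- new state and sent messages after receiving a message from the given sender -/
  onRecv : Fin n → State → Coin → Fin n → Msg → State × (Fin n → List Msg)
  /-- the value output in a local state, if any -/
  out : Fin n → State → Option (Param d)

attribute [instance] ClusterAlg.coinMeas ClusterAlg.isProb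

/-- What an adversary can schedule: a memory step of process `i`, or the delivery to process `i` of
the `k`-th message (counted from 0) sent to it by process `j`. -/
inductive Event (n : ℕ) : Type
  | op (i : Fin n)
  | recv (i j : Fin n) (k : ℕ)

/-- The process that takes the step. -/
def Event.proc {n : ℕ} : Event n → Fin n
  | .op i => i
  | .recv i _ _ => i

/-- The weak adversary observes neither coins, nor memory, nor messages: it fixes the infinite
sequence of events in advance. A schedule, together with an algorithm, determines an execution
tree, in which only the coins branch. -/
abbrev Schedule (n : ℕ) : Type := ℕ → Event n

namespace Schedule

variable {n : ℕ} (σ : Schedule n)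

/-- The processes that do not crash, i.e. do not stop taking steps. This set is the same for all
executions in the tree of `σ`. -/
def survivors : Set (Fin n) := {i | ∃ᶠ t in atTop, (σ t).proc = i}

/-- Asynchronous, but reliable: a surviving process takes infinitely many memory steps, and the
delivery of every message to it is attempted again and again, so that every message sent to it is
delivered after a finite, arbitrarily long delay. -/
def Fair : Prop := ∀ i ∈ σ.survivors,
  (∃ᶠ t in atTop, σ t = .op i) ∧ ∀ j k, ∃ᶠ t in atTop, σ t = .recv i j k

end Schedule

namespace ClusterAlg

variable {n m d : ℕ} (A : ClusterAlg.{u} n m d) (cluster : Fin n → Fin m)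

/-- A configuration: local states, shared memories, messages sent from `i` to `j` so far (in the
order of sending), the triples (sender, receiver, index) of messages delivered so far, and the
number of coins each process has used. The pending messages are those sent and not delivered. -/
structure Config where
  state : Fin n → A.State
  mem : Fin m → A.Reg → A.Val
  sent : Fin n → Fin n → List A.Msg
  delivered : Set (Fin n × Fin n × ℕ)
  used : Fin n → ℕ

/-- An outcome of all coins: `ω (i, k)` is the `k`-th coin of process `i`. -/
abbrev Coins : Type u := Fin n × ℕ → A.Coin

/-- All coins are independent. -/
def prob : Measure A.Coins := Measure.infinitePi fun _ : Fin n × ℕ => A.coinLaw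

/-- The initial configuration. -/
def initConfig : A.Config where
  state := A.init
  mem := A.memInit
  sent _ _ := []
  delivered := ∅
  used _ := 0

variable {A}

/-- Process `i` consumes a coin, moves to a new local state and sends messages. -/
def Config.move (c : A.Config) (i : Fin n) (q : A.State × (Fin n → List A.Msg)) : A.Config where
  state := Function.update c.state i q.1
  mem := c.mem
  sent := Function.update c.sent i fun j => c.sent i j ++ q.2 j
  delivered := c.delivered
  used := Function.update c.used i (c.used i + 1)

variable (A)

open Classical in
/-- The effect of a scheduled event. Nothing happens if the message to be delivered is not
pending. -/
def apply (ω : A.Coins) (c : A.Config) : Event n → A.Config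
  | .op i =>
    match A.memOp i (c.state i) (ω (i, c.used i)) with
    | .skip => c.move i (A.afterOp i (c.state i) (ω (i, c.used i)) none)
    | .read r =>
      c.move i (A.afterOp i (c.state i) (ω (i, c.used i)) (some (c.mem (cluster i) r)))
    | .write r v =>
      { c.move i (A.afterOp i (c.state i) (ω (i, c.used i)) none) with
        mem := Function.update c.mem (cluster i) (Function.update (c.mem (cluster i)) r v) }
  | .recv i j k =>
    match (c.sent j i)[k]? with
    | none => c
    | some x =>
      if (j, i, k) ∈ c.delivered then c
      else
        { c.move i (A.onRecv i (c.state i) (ω (i, c.used i)) j x) with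
          delivered := insert (j, i, k) c.delivered }

/-- The configuration after `t` events of the schedule `σ`. -/
def run (σ : Schedule n) (ω : A.Coins) : ℕ → A.Config
  | 0 => A.initConfig
  | t + 1 => A.apply cluster ω (run σ ω t) (σ t)

open Classical in
/-- The output of process `i`: the first value it outputs in the execution; `none` if it never
outputs a value. A value that was output is not withdrawn if the process crashes afterwards. -/
def output (σ : Schedule n) (i : Fin n) (ω : A.Coins) : Option (Param d) :=
  if h : ∃ t, (A.out i ((A.run cluster σ ω t).state i)).isSome then
    A.out i ((A.run cluster σ ω (Nat.find h)).state i)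
  else none

open Classical in
/-- The same, but disregarding every process that crashes at any time. -/
def survivorOutput (σ : Schedule n) (i : Fin n) (ω : A.Coins) : Option (Param d) :=
  if i ∈ σ.survivors then A.output cluster σ i ω else none

end ClusterAlg

/-! ### Distributed implementation of sequential SGD -/

/-- `‖x - y‖ ^ 2`, and `0` if one of the values is missing. -/
def sqDist {d : ℕ} : Option (Param d) → Option (Param d) → ℝ≥0∞
  | some x, some y => ENNReal.ofReal (‖x - y‖ ^ 2)
  | _, _ => 0

/-- `‖∇Q(x)‖ ^ 2`, and `0` if the value is missing. -/
def sqGrad {d : ℕ} (Q : Param d → ℝ) : Option (Param d) → ℝ≥0∞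
  | some x => ENNReal.ofReal (‖gradient Q x‖ ^ 2)
  | none => 0

/-- The random outputs `X i` of `n` processes, those in `N` being nonfaulty, converge externally
with error `ε` and internally with error `δ`, and preserve the convergence distribution of the
sequential algorithm `M`. The last condition is imposed on the sets of processes that contain a
nonfaulty one: a set of processes without outputs can never satisfy it. It also forces each
nonfaulty process to output a value almost surely (take for `S` the whole space). -/
structure Implements {n d : ℕ} {Ω : Type u} [MeasurableSpace Ω] (μ : Measure Ω)
    (X : Fin n → Ω → Option (Param d)) (N : Set (Fin n)) (M : SeqSGD.{v} d) (ε δ : ℝ) : Prop where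
  /-- the outputs are random variables -/
  measurable : ∀ i, ∀ B : Set (Param d), MeasurableSet B → MeasurableSet {ω | ∃ x ∈ B, X i ω = some x}
  external : ∀ i, ∫⁻ ω, sqGrad M.cost (X i ω) ∂μ ≤ ENNReal.ofReal ε
  internal : ∀ i j, ∫⁻ ω, sqDist (X i ω) (X j ω) ∂μ ≤ ENNReal.ofReal δ
  preserves : ∀ (β : ℝ) (S : Set (Param d)) (P : Set (Fin n)), 0 < β → (P ∩ N).Nonempty →
    M.prob (M.near β S) ≤ μ {ω | ∃ x ∈ S, ∃ i ∈ P, ∃ y, X i ω = some y ∧ ‖y - x‖ ≤ β}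

end

/-! The proof is a partition argument. Take two disjoint groups of clusters, `C₁` and `C₂`. If only
`C₁` takes steps, preservation of the convergence distribution puts some output of `C₁` near `S₁`
with at least the sequential probability; the same holds for `C₂` and `S₂`. The two solo runs use
disjoint sets of coins, so both events occur together with probability at least `p`
(`infinitePi_inter_eq_mul`).

On the other hand, finite beginnings of the two solo runs can be put one after the other in a single
execution in which no message between the groups is delivered yet. No process notices the difference
(`Agree.foldl_filter`, `Agree.foldl_external`), and the outputs made so far stay valid in every
continuation. If some continuation is subject to internal convergence, then Markov's inequality and
a union bound over the `n ^ 2` pairs of processes bound the probability of two outputs at distance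
`γ` or more by `δ n ^ 2 / γ ^ 2`. This bound does not depend on the beginning, so it survives the
limit of longer and longer beginnings, and `p ≤ δ n ^ 2 / γ ^ 2` (`split_le`).

The limit is taken over finite beginnings because cutting off communication forever is not fair when
both groups survive, while no finite beginning violates fairness. -/

/-! ### Schedules -/

namespace Schedule

variable {n : ℕ}

/-- The first `t` events of a schedule. -/
def initial (σ : Schedule n) (t : ℕ) : List (Event n) := (List.range t).map σ

theorem initial_succ (σ : Schedule n) (t : ℕ) : σ.initial (t + 1) = σ.initial t ++ [σ t] := by
  simp [initial, List.range_succ]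

theorem initial_add (σ : Schedule n) (t s : ℕ) : ∃ L, σ.initial (t + s) = σ.initial t ++ L := by
  induction s with
  | zero => exact ⟨[], by simp⟩
  | succ s ih =>
    obtain ⟨L, hL⟩ := ih
    exact ⟨L ++ [σ (t + s)], by rw [← add_assoc, initial_succ, hL, List.append_assoc]⟩

theorem mem_initial {σ : Schedule n} {t : ℕ} {e : Event n} (he : e ∈ σ.initial t) :
    ∃ s, σ s = e := by
  simp only [initial, List.mem_map] at he
  obtain ⟨s, -, hs⟩ := he
  exact ⟨s, hs⟩

/-- The schedule that begins with the events of `L` and continues with `σ`. -/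
def after (L : List (Event n)) (σ : Schedule n) : Schedule n :=
  fun t => if h : t < L.length then L[t] else σ (t - L.length)

theorem initial_after (L : List (Event n)) (σ : Schedule n) :
    (after L σ).initial L.length = L := by
  apply List.ext_getElem
  · simp [initial]
  · intro t h₁ h₂
    simp [initial, after, h₂]

theorem after_add (L : List (Event n)) (σ : Schedule n) (t : ℕ) :
    after L σ (L.length + t) = σ t := by
  simp [after]

/-- Every event of a process in `G` occurs infinitely often, and the processes outside `G` take
only finitely many steps. -/
def ThoroughOn (σ : Schedule n) (G : Set (Fin n)) : Prop :=
  (∀ e : Event n, e.proc ∈ G → ∃ᶠ t in atTop, σ t = e) ∧ ∀ᶠ t in atTop, (σ t).proc ∈ G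

theorem ThoroughOn.survivors_eq {σ : Schedule n} {G : Set (Fin n)} (h : σ.ThoroughOn G) :
    σ.survivors = G := by
  ext i
  refine ⟨fun hi => ?_, fun hi => ?_⟩
  · obtain ⟨t, rfl, ht⟩ := (Frequently.and_eventually hi h.2).exists
    exact ht
  · exact (h.1 (.op i) hi).mono fun t ht => by rw [ht]; rfl

theorem ThoroughOn.fair {σ : Schedule n} {G : Set (Fin n)} (h : σ.ThoroughOn G) : σ.Fair := by
  intro i hi
  rw [h.survivors_eq] at hi
  exact ⟨h.1 (.op i) hi, fun j k => h.1 (.recv i j k) hi⟩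

/-- Survival and fairness concern only the tail of a schedule, so any finite beginning is
admissible, even one with steps of processes that crash later. -/
theorem ThoroughOn.after {σ : Schedule n} {G : Set (Fin n)} (h : σ.ThoroughOn G)
    (L : List (Event n)) : (after L σ).ThoroughOn G := by
  constructor
  · intro e he
    have := h.1 e he
    rw [frequently_atTop] at this ⊢
    intro a
    obtain ⟨b, hb, hbe⟩ := this a
    exact ⟨L.length + b, by omega, by rw [after_add, hbe]⟩
  · obtain ⟨a, ha⟩ := eventually_atTop.1 h.2
    refine eventually_atTop.2 ⟨L.length + a, fun b hb => ?_⟩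
    obtain ⟨c, rfl⟩ := Nat.exists_eq_add_of_le (show L.length ≤ b by omega)
    rw [after_add]
    exact ha c (by omega)

end Schedule

/-! ### Schedules in which one group runs alone -/

instance Event.instCountable {n : ℕ} : Countable (Event n) := by
  let f : Event n → Fin n ⊕ (Fin n × Fin n × ℕ) := fun
    | .op i => .inl i
    | .recv i j k => .inr (i, j, k)
  refine Function.Injective.countable (f := f) fun a b hab => ?_
  cases a <;> cases b <;> simp_all [f]

namespace Schedule

variable {n : ℕ}

/-- Enumerate the countably many events of `G` and use only the first component of `Nat.unpair` as
index: the event numbered `a` recurs at all times `Nat.pair a b ≥ b`. The last clause goes beyond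
`ThoroughOn`: processes outside `G` never take a step, hence send nothing and use no coins. -/
theorem exists_thoroughOn {G : Set (Fin n)} (hG : G.Nonempty) :
    ∃ σ : Schedule n, σ.ThoroughOn G ∧ ∀ t, (σ t).proc ∈ G := by
  obtain ⟨i, hi⟩ := hG
  have : Nonempty {e : Event n // e.proc ∈ G} := ⟨⟨.op i, hi⟩⟩
  obtain ⟨f, hf⟩ := exists_surjective_nat {e : Event n // e.proc ∈ G}
  refine ⟨fun t => (f t.unpair.1).1, ⟨fun e he => ?_, .of_forall fun t => (f _).2⟩,
    fun t => (f _).2⟩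
  obtain ⟨a, ha⟩ := hf ⟨e, he⟩
  rw [frequently_atTop]
  intro b
  exact ⟨Nat.pair a b, Nat.right_le_pair a b, by simp [ha]⟩

end Schedule

/-! ### Executions along finite lists of events, with a record of the first outputs -/

namespace ClusterAlg

variable {n m d : ℕ} (A : ClusterAlg.{u} n m d) (cluster : Fin n → Fin m)

/-- The effect of an event on a configuration together with the record of the first outputs. -/
noncomputable def track (ω : A.Coins) (x : A.Config × (Fin n → Option (Param d))) (e : Event n) :
    A.Config × (Fin n → Option (Param d)) :=
  (A.apply cluster ω x.1 e,
    fun i => (x.2 i).or (A.out i ((A.apply cluster ω x.1 e).state i)))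

/-- The initial configuration and the outputs in it. -/
def trackInit : A.Config × (Fin n → Option (Param d)) :=
  (A.initConfig, fun i => A.out i (A.init i))

/-- The configuration and the record of the first outputs after the events of a list. -/
noncomputable def tracked (ω : A.Coins) (L : List (Event n)) : A.Config × (Fin n → Option (Param d)) :=
  L.foldl (A.track cluster ω) A.trackInit

theorem tracked_concat (ω : A.Coins) (L : List (Event n)) (e : Event n) :
    A.tracked cluster ω (L ++ [e]) = A.track cluster ω (A.tracked cluster ω L) e := by
  simp [tracked]

theorem tracked_append_eq_some {ω : A.Coins} {L L' : List (Event n)} {i : Fin n} {y : Param d}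
    (h : (A.tracked cluster ω L).2 i = some y) :
    (A.tracked cluster ω (L ++ L')).2 i = some y := by
  induction L' using List.reverseRecOn with
  | nil => simpa using h
  | append_singleton L' e ih =>
    rw [← List.append_assoc, tracked_concat]
    simp [track, ih]

theorem tracked_initial_mono {σ : Schedule n} {ω : A.Coins} {s t : ℕ} (hst : s ≤ t) {i : Fin n}
    {y : Param d} (h : (A.tracked cluster ω (σ.initial s)).2 i = some y) :
    (A.tracked cluster ω (σ.initial t)).2 i = some y := by
  obtain ⟨r, rfl⟩ := Nat.exists_eq_add_of_le hst
  obtain ⟨L, hL⟩ := σ.initial_add s r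
  rw [hL]
  exact A.tracked_append_eq_some cluster h

theorem tracked_initial_fst (σ : Schedule n) (ω : A.Coins) (t : ℕ) :
    (A.tracked cluster ω (σ.initial t)).1 = A.run cluster σ ω t := by
  induction t with
  | zero => rfl
  | succ t ih =>
    rw [Schedule.initial_succ, tracked_concat]
    simp only [track, run, ih]

theorem tracked_initial_snd_succ (σ : Schedule n) (ω : A.Coins) (t : ℕ) (i : Fin n) :
    (A.tracked cluster ω (σ.initial (t + 1))).2 i =
      ((A.tracked cluster ω (σ.initial t)).2 i).or
        (A.out i ((A.run cluster σ ω (t + 1)).state i)) := by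
  rw [Schedule.initial_succ, tracked_concat]
  simp only [track, run, tracked_initial_fst]

theorem tracked_initial_eq_none_iff (σ : Schedule n) (ω : A.Coins) (t : ℕ) (i : Fin n) :
    (A.tracked cluster ω (σ.initial t)).2 i = none ↔
      ∀ s ≤ t, A.out i ((A.run cluster σ ω s).state i) = none := by
  induction t with
  | zero => simp [Schedule.initial, tracked, trackInit, run, initConfig]
  | succ t ih =>
    rw [tracked_initial_snd_succ, Option.or_eq_none_iff, ih]
    constructor
    · rintro ⟨h₁, h₂⟩ s hs
      rcases Nat.le_succ_iff.1 hs with hs | rfl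
      exacts [h₁ s hs, h₂]
    · exact fun h => ⟨fun s hs => h s (by omega), h _ le_rfl⟩

theorem output_eq_some_of_first {σ : Schedule n} {ω : A.Coins} {t : ℕ} {i : Fin n} {y : Param d}
    (h : A.out i ((A.run cluster σ ω t).state i) = some y)
    (hlt : ∀ s < t, A.out i ((A.run cluster σ ω s).state i) = none) :
    A.output cluster σ i ω = some y := by
  classical
  have hex : ∃ t, (A.out i ((A.run cluster σ ω t).state i)).isSome := ⟨t, by simp [h]⟩
  have hfind : Nat.find hex = t :=
    (Nat.find_eq_iff hex).2 ⟨by simp [h], fun s hs => by simp [hlt s hs]⟩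
  rw [output, dif_pos hex]
  convert h

/-- Expresses the output through finite lists of events, which, unlike infinite schedules, can be
cut, filtered and concatenated. -/
theorem output_eq_some_iff {σ : Schedule n} {ω : A.Coins} {i : Fin n} {y : Param d} :
    A.output cluster σ i ω = some y ↔
      ∃ t, (A.tracked cluster ω (σ.initial t)).2 i = some y := by
  classical
  constructor
  · intro h
    by_cases hex : ∃ t, (A.out i ((A.run cluster σ ω t).state i)).isSome
    · rw [output, dif_pos hex] at h
      have hlt : ∀ s < Nat.find hex, A.out i ((A.run cluster σ ω s).state i) = none :=
        fun s hs => by simpa using Nat.find_min hex hs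
      generalize ht : Nat.find hex = t at hlt
      have h' : A.out i ((A.run cluster σ ω t).state i) = some y := by
        rw [← h, ← ht]
      refine ⟨t, ?_⟩
      cases t with
      | zero => exact h'
      | succ t =>
        rw [tracked_initial_snd_succ, h',
          (A.tracked_initial_eq_none_iff cluster σ ω t i).2 fun s hs => hlt s (by omega)]
        rfl
    · rw [output, dif_neg hex] at h
      cases h
  · rintro ⟨t, ht⟩
    induction t with
    | zero => exact A.output_eq_some_of_first cluster (t := 0) ht (by simp)
    | succ t ih =>
      rw [tracked_initial_snd_succ, Option.or_eq_some_iff] at ht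
      rcases ht with ht | ⟨hn, hs⟩
      · exact ih ht
      · rw [tracked_initial_eq_none_iff] at hn
        exact A.output_eq_some_of_first cluster hs fun s hs => hn s (by omega)

theorem output_eq_some_of_tracked {σ : Schedule n} {ω : A.Coins} {L : List (Event n)}
    (hL : σ.initial L.length = L) {i : Fin n} {y : Param d}
    (h : (A.tracked cluster ω L).2 i = some y) : A.output cluster σ i ω = some y :=
  (A.output_eq_some_iff cluster).2 ⟨L.length, by rwa [hL]⟩

/-! ### Dependence on coins -/

theorem apply_congr_coins {ω ω' : A.Coins} (c : A.Config) (e : Event n)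
    (h : ∀ k, ω (e.proc, k) = ω' (e.proc, k)) :
    A.apply cluster ω c e = A.apply cluster ω' c e := by
  cases e <;> simp only [Event.proc] at h <;> simp only [apply, h]

/-- Each event reads only coins of the process that takes the step. This is the source of the
independence of the two solo runs. -/
theorem output_congr_coins {σ : Schedule n} {ω ω' : A.Coins}
    (h : ∀ t k, ω ((σ t).proc, k) = ω' ((σ t).proc, k)) (i : Fin n) :
    A.output cluster σ i ω = A.output cluster σ i ω' := by
  have hrun : A.run cluster σ ω = A.run cluster σ ω' := by
    funext t
    induction t with
    | zero => rfl
    | succ t ih => rw [run, run, ih, A.apply_congr_coins cluster _ _ (h t)]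
  unfold output
  rw [hrun]

/-! ### Groups of clusters that do not communicate -/

/-- The event concerns only processes of clusters in `C`. -/
def Internal (C : Set (Fin m)) : Event n → Prop
  | .op i => cluster i ∈ C
  | .recv i j _ => cluster i ∈ C ∧ cluster j ∈ C

theorem Internal.proc_mem {C : Set (Fin m)} {e : Event n} (h : Internal cluster C e) :
    cluster e.proc ∈ C := by
  cases e with
  | op i => exact h
  | recv i j k => exact h.1

variable {A}

/-- The processes and memories of the clusters in `C`, and the messages among them, are the same
in both configurations. -/
structure Config.Agree (C : Set (Fin m)) (c c' : A.Config) : Prop where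
  state : ∀ i, cluster i ∈ C → c.state i = c'.state i
  used : ∀ i, cluster i ∈ C → c.used i = c'.used i
  mem : ∀ q ∈ C, c.mem q = c'.mem q
  sent : ∀ i j, cluster i ∈ C → cluster j ∈ C → c.sent i j = c'.sent i j
  delivered : ∀ i j k, cluster i ∈ C → cluster j ∈ C →
    ((i, j, k) ∈ c.delivered ↔ (i, j, k) ∈ c'.delivered)

/-- The configurations agree on `C`, and so do the first outputs, which have all been recorded. -/
structure Agree (C : Set (Fin m)) (x x' : A.Config × (Fin n → Option (Param d))) : Prop where
  config : Config.Agree cluster C x.1 x'.1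
  record : ∀ i, cluster i ∈ C → x.2 i = x'.2 i
  recorded : ∀ i, cluster i ∈ C → (x.2 i).or (A.out i (x.1.state i)) = x.2 i

variable {cluster} {C : Set (Fin m)} {c c' : A.Config}
  {x x' : A.Config × (Fin n → Option (Param d))}

theorem agree_trackInit : Agree cluster C A.trackInit A.trackInit where
  config := ⟨fun _ _ => rfl, fun _ _ => rfl, fun _ _ => rfl, fun _ _ _ _ => rfl,
    fun _ _ _ _ _ => Iff.rfl⟩
  record _ _ := rfl
  recorded i _ := by simp [trackInit, initConfig]

theorem apply_of_ne_proc {ω : A.Coins} (c : A.Config) {e : Event n} {i : Fin n}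
    (hi : i ≠ e.proc) : (A.apply cluster ω c e).state i = c.state i ∧
      (A.apply cluster ω c e).used i = c.used i ∧
      (A.apply cluster ω c e).sent i = c.sent i := by
  cases e with
  | op j =>
    simp only [Event.proc] at hi
    simp only [apply]
    split <;> simp [Config.move, hi]
  | recv j l k =>
    simp only [Event.proc] at hi
    simp only [apply]
    split
    · simp
    · split <;> simp [Config.move, hi]

theorem apply_mem_of_ne {ω : A.Coins} (c : A.Config) {e : Event n} {q : Fin m}
    (hq : q ≠ cluster e.proc) : (A.apply cluster ω c e).mem q = c.mem q := by
  cases e with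
  | op j =>
    simp only [Event.proc] at hq
    simp only [apply]
    split <;> simp [Config.move, hq]
  | recv j l k =>
    simp only [apply]
    split
    · simp
    · split <;> simp [Config.move]

theorem mem_apply_delivered_of_ne {ω : A.Coins} (c : A.Config) {e : Event n} {i j : Fin n} {k : ℕ}
    (hj : j ≠ e.proc) :
    (i, j, k) ∈ (A.apply cluster ω c e).delivered ↔ (i, j, k) ∈ c.delivered := by
  cases e with
  | op l =>
    simp only [apply]
    split <;> simp [Config.move]
  | recv l i' k =>
    simp only [Event.proc] at hj
    simp only [apply]
    split
    · simp
    · split <;> simp [hj]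

/-- A step outside `C` may send messages into `C`, but `Agree` compares only messages between
members of `C`, and a pending message has no effect before its delivery. -/
theorem Agree.track_external (h : Agree cluster C x x') (ω : A.Coins) {e : Event n}
    (he : cluster e.proc ∉ C) : Agree cluster C x (A.track cluster ω x' e) := by
  have hne : ∀ {i}, cluster i ∈ C → i ≠ e.proc := by
    rintro i hi rfl
    exact he hi
  refine ⟨⟨fun i hi => ?_, fun i hi => ?_, fun q hq => ?_, fun i j hi hj => ?_,
    fun i j k hi hj => ?_⟩, fun i hi => ?_, h.recorded⟩
  · rw [h.config.state i hi]
    exact (apply_of_ne_proc _ (hne hi)).1.symm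
  · rw [h.config.used i hi]
    exact (apply_of_ne_proc _ (hne hi)).2.1.symm
  · rw [h.config.mem q hq]
    refine (apply_mem_of_ne _ ?_).symm
    rintro rfl
    exact he hq
  · rw [h.config.sent i j hi hj]
    exact congrFun (apply_of_ne_proc _ (hne hi)).2.2.symm j
  · rw [h.config.delivered i j k hi hj]
    exact (mem_apply_delivered_of_ne _ (hne hj)).symm
  -- `track` evaluates `out` at every process after every event; by `recorded` this adds nothing as
  -- long as the state is unchanged.
  · have := h.recorded i hi
    simp only [track]
    rw [(apply_of_ne_proc _ (hne hi)).1, ← h.config.state i hi, ← h.record i hi, this]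

theorem Config.Agree.move (h : Config.Agree cluster C c c') (i : Fin n)
    (q : A.State × (Fin n → List A.Msg)) :
    Config.Agree cluster C (c.move i q) (c'.move i q) := by
  refine ⟨fun l hl => ?_, fun l hl => ?_, h.mem, fun l j hl hj => ?_, h.delivered⟩ <;>
    by_cases hli : l = i
  · subst hli; simp [Config.move]
  · simp [Config.move, hli, h.state l hl]
  · subst hli; simp [Config.move, h.used l hl]
  · simp [Config.move, hli, h.used l hl]
  · subst hli; simp [Config.move, h.sent l j hl hj]
  · simp [Config.move, hli, h.sent l j hl hj]

theorem Config.Agree.apply_internal (h : Config.Agree cluster C c c') (ω : A.Coins) {e : Event n}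
    (he : Internal cluster C e) :
    Config.Agree cluster C (A.apply cluster ω c e) (A.apply cluster ω c' e) := by
  cases e with
  | op i =>
    have hi : cluster i ∈ C := he
    simp only [apply, ← h.state i hi, ← h.used i hi, ← h.mem _ hi]
    cases A.memOp i (c.state i) (ω (i, c.used i)) with
    | skip => exact h.move i _
    | read r => exact h.move i _
    | write r v =>
      have hm := h.move i (A.afterOp i (c.state i) (ω (i, c.used i)) none)
      refine ⟨hm.state, hm.used, fun q hq => ?_, hm.sent, hm.delivered⟩
      by_cases hqi : q = cluster i
      · subst hqi; simp
      · simp [hqi, h.mem q hq]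
  | recv i j k =>
    obtain ⟨hi, hj⟩ : cluster i ∈ C ∧ cluster j ∈ C := he
    have hdel := h.delivered j i k hj hi
    simp only [apply, ← h.state i hi, ← h.used i hi, ← h.sent j i hj hi]
    cases (c.sent j i)[k]? with
    | none => exact h
    | some a =>
      dsimp only
      by_cases hd : (j, i, k) ∈ c.delivered
      · rw [if_pos hd, if_pos (hdel.1 hd)]
        exact h
      · rw [if_neg hd, if_neg (mt hdel.2 hd)]
        have hm := h.move i (A.onRecv i (c.state i) (ω (i, c.used i)) j a)
        refine ⟨hm.state, hm.used, hm.mem, hm.sent, fun i' j' l hi' hj' => ?_⟩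
        simp only [Set.mem_insert_iff]
        exact or_congr Iff.rfl (h.delivered i' j' l hi' hj')

theorem Agree.track_internal (h : Agree cluster C x x') (ω : A.Coins) {e : Event n}
    (he : Internal cluster C e) :
    Agree cluster C (A.track cluster ω x e) (A.track cluster ω x' e) where
  config := h.config.apply_internal ω he
  record i hi := by
    simp only [track, h.record i hi, (h.config.apply_internal ω he).state i hi]
  recorded i hi := by simp [track, Option.or_assoc]

theorem Agree.foldl_external (h : Agree cluster C x x') (ω : A.Coins) {L : List (Event n)}
    (hL : ∀ e ∈ L, cluster e.proc ∉ C) :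
    Agree cluster C x (L.foldl (A.track cluster ω) x') := by
  induction L generalizing x' with
  | nil => exact h
  | cons e L ih =>
    exact ih (h.track_external ω (hL e (by simp))) fun e he => hL e (by simp [he])

/-- As long as nothing is sent from outside `C`, the clusters in `C` cannot tell whether the
deliveries of messages from outside are scheduled. -/
theorem Agree.foldl_filter (h : Agree cluster C x x') (ω : A.Coins)
    {L : List (Event n)} (hL : ∀ e ∈ L, cluster e.proc ∈ C)
    (hsent : ∀ j, cluster j ∉ C → ∀ i, x.1.sent j i = []) (p : Event n → Bool)
    (hp : ∀ e, p e = true ↔ Internal cluster C e) :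
    Agree cluster C (L.foldl (A.track cluster ω) x)
      ((L.filter p).foldl (A.track cluster ω) x') := by
  induction L generalizing x x' with
  | nil => exact h
  | cons e L ih =>
    have he := hL e (by simp)
    have hL' : ∀ e ∈ L, cluster e.proc ∈ C := fun e he => hL e (by simp [he])
    have hsent' : ∀ j, cluster j ∉ C → ∀ i, (A.track cluster ω x e).1.sent j i = [] := by
      intro j hj i
      rw [← hsent j hj i]
      refine congrFun (apply_of_ne_proc _ ?_).2.2 i
      rintro rfl
      exact hj he
    rw [List.foldl_cons]
    by_cases hpe : p e = true
    · rw [List.filter_cons_of_pos hpe, List.foldl_cons]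
      exact ih (h.track_internal ω ((hp e).1 hpe)) hL' hsent'
    · rw [List.filter_cons_of_neg hpe]
      refine ih ?_ hL' hsent'
      -- The only events that the filter drops are deliveries from outside `C`. Nothing was sent
      -- from there in `x`, so they do nothing.
      have happly : A.apply cluster ω x.1 e = x.1 := by
        rw [hp] at hpe
        cases e with
        | op i => exact absurd he hpe
        | recv i j k =>
          have hj : cluster j ∉ C := fun hj => hpe ⟨he, hj⟩
          simp [apply, hsent j hj i]
      have htrack : ∀ i, cluster i ∈ C → (A.track cluster ω x e).2 i = x.2 i := fun i hi => by
        simp only [track, happly, h.recorded i hi]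
      refine ⟨?_, fun i hi => (htrack i hi).trans (h.record i hi), fun i hi => ?_⟩
      · simpa only [track, happly] using h.config
      · rw [htrack i hi]
        simpa only [track, happly] using h.recorded i hi

variable (A cluster)

open Classical in
/-- The events of a list that concern only processes of clusters in `C`. -/
noncomputable def internalPart (C : Set (Fin m)) (L : List (Event n)) : List (Event n) :=
  L.filter fun e => decide (Internal cluster C e)

theorem proc_mem_of_mem_internalPart {C : Set (Fin m)} {L : List (Event n)} {e : Event n}
    (he : e ∈ internalPart cluster C L) : cluster e.proc ∈ C := by
  simp only [internalPart, List.mem_filter, decide_eq_true_eq] at he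
  exact he.2.proc_mem

/-- The filter is necessary: deliveries from `C₂` are without effect in the solo run of `C₁`, but in
a common execution they could find pending messages. -/
theorem tracked_internalPart_append_left {C₁ C₂ : Set (Fin m)} (hC : Disjoint C₁ C₂) (ω : A.Coins)
    {L₁ : List (Event n)} (L₂ : List (Event n)) (h₁ : ∀ e ∈ L₁, cluster e.proc ∈ C₁)
    {i : Fin n} (hi : cluster i ∈ C₁) :
    (A.tracked cluster ω (internalPart cluster C₁ L₁ ++ internalPart cluster C₂ L₂)).2 i =
      (A.tracked cluster ω L₁).2 i := by
  rw [tracked, tracked, List.foldl_append]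
  refine (((agree_trackInit (A := A)).foldl_filter ω h₁ (fun _ _ _ => rfl) _
    (fun e => by simp)).foldl_external ω (L := internalPart cluster C₂ L₂)
      fun e he => ?_).record i hi |>.symm
  exact Set.disjoint_right.1 hC (proc_mem_of_mem_internalPart cluster he)

/-- Here `C₂` starts when messages from `C₁` may already be pending. This is harmless, since
`foldl_filter` asks for the absence of outside messages only on the unfiltered side, the solo run.
-/
theorem tracked_internalPart_append_right {C₁ C₂ : Set (Fin m)} (hC : Disjoint C₁ C₂) (ω : A.Coins)
    (L₁ : List (Event n)) {L₂ : List (Event n)} (h₂ : ∀ e ∈ L₂, cluster e.proc ∈ C₂)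
    {i : Fin n} (hi : cluster i ∈ C₂) :
    (A.tracked cluster ω (internalPart cluster C₁ L₁ ++ internalPart cluster C₂ L₂)).2 i =
      (A.tracked cluster ω L₂).2 i := by
  rw [tracked, tracked, List.foldl_append]
  have h := (agree_trackInit (A := A) (cluster := cluster) (C := C₂)).foldl_external ω
    (L := internalPart cluster C₁ L₁)
    fun e he => Set.disjoint_left.1 hC (proc_mem_of_mem_internalPart cluster he)
  exact ((h.foldl_filter ω h₂ (fun _ _ _ => rfl) _ (fun e => by simp)).record i hi).symm

end ClusterAlg

/-! ### Probability -/

/-- A measurable set that depends only on the coordinates in `I` belongs to the σ-algebra that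
they generate. -/
theorem measurableSet_iSup_comap_of_dependsOn {ι X : Type*} [MeasurableSpace X] {I : Set ι}
    {E : Set (ι → X)} (hE : MeasurableSet E) (hI : DependsOn (· ∈ E) I) :
    MeasurableSet[⨆ a ∈ I, MeasurableSpace.comap (fun ω : ι → X => ω a) inferInstance] E := by
  classical
  rcases isEmpty_or_nonempty (ι → X) with h | ⟨⟨ω₀⟩⟩
  · rw [Set.eq_empty_of_isEmpty E]
    exact @MeasurableSet.empty _ (_)
  -- Freezing the coordinates outside `I` at those of `ω₀` does not affect membership in `E`, and
  -- the frozen point is a measurable function of the coordinates in `I`.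
  let f : (ι → X) → ι → X := fun ω a => if a ∈ I then ω a else ω₀ a
  have hf : Measurable[⨆ a ∈ I, MeasurableSpace.comap (fun ω : ι → X => ω a) inferInstance] f := by
    refine @measurable_pi_lambda _ _ _ (_) _ _ fun a => ?_
    by_cases ha : a ∈ I
    · simp only [f, ha, if_true]
      exact (comap_measurable _).mono (le_iSup₂_of_le a ha le_rfl) le_rfl
    · simp only [f, ha, if_false]
      exact @measurable_const _ _ _ (_) _
  have hEf : E = f ⁻¹' E := by
    ext ω
    exact iff_of_eq (hI fun a ha => by simp [f, ha])
  rw [hEf]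
  exact hf hE

/-- Events that depend on disjoint sets of coordinates are independent. -/
theorem infinitePi_inter_eq_mul {ι X : Type*} [MeasurableSpace X] (P : ι → Measure X)
    [∀ a, IsProbabilityMeasure (P a)] {I₁ I₂ : Set ι} (hI : Disjoint I₁ I₂) {E₁ E₂ : Set (ι → X)}
    (hE₁ : MeasurableSet E₁) (hE₂ : MeasurableSet E₂) (h₁ : DependsOn (· ∈ E₁) I₁)
    (h₂ : DependsOn (· ∈ E₂) I₂) :
    Measure.infinitePi P (E₁ ∩ E₂) = Measure.infinitePi P E₁ * Measure.infinitePi P E₂ := by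
  have hind : iIndep (fun a => MeasurableSpace.comap (fun ω : ι → X => ω a) inferInstance)
      (Measure.infinitePi P) :=
    (iIndepFun_infinitePi (P := P) (X := fun _ x => x) fun _ => measurable_id).iIndep
  exact (Indep_iff _ _ _).1
    (indep_iSup_of_disjoint (fun a => (measurable_pi_apply a).comap_le) hind hI) _ _
    (measurableSet_iSup_comap_of_dependsOn hE₁ h₁) (measurableSet_iSup_comap_of_dependsOn hE₂ h₂)

/-- If two random points are close in mean square, they can hardly lie in distant sets. -/
theorem measure_mem_mem_le {d : ℕ} {Ω : Type*} [MeasurableSpace Ω] {μ : Measure Ω}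
    {X Y : Ω → Option (Param d)} {B₁ B₂ : Set (Param d)} {γ δ : ℝ} (hγ : 0 < γ)
    (hB : ∀ y₁ ∈ B₁, ∀ y₂ ∈ B₂, γ ≤ ‖y₁ - y₂‖)
    (hX : MeasurableSet {ω | ∃ y ∈ B₁, X ω = some y})
    (hY : MeasurableSet {ω | ∃ y ∈ B₂, Y ω = some y})
    (h : ∫⁻ ω, sqDist (X ω) (Y ω) ∂μ ≤ ENNReal.ofReal δ) :
    μ ({ω | ∃ y ∈ B₁, X ω = some y} ∩ {ω | ∃ y ∈ B₂, Y ω = some y}) ≤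
      ENNReal.ofReal (δ / γ ^ 2) := by
  set D := {ω | ∃ y ∈ B₁, X ω = some y} ∩ {ω | ∃ y ∈ B₂, Y ω = some y}
  have hD : MeasurableSet D := hX.inter hY
  -- Markov's inequality: the squared distance is at least `γ ^ 2` on `D`.
  have hle : ENNReal.ofReal (γ ^ 2) * μ D ≤ ENNReal.ofReal δ := by
    rw [← lintegral_indicator_const hD]
    refine (lintegral_mono fun ω => ?_).trans h
    by_cases hω : ω ∈ D
    · rw [Set.indicator_of_mem hω]
      obtain ⟨⟨y₁, hy₁, h₁⟩, y₂, hy₂, h₂⟩ := hω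
      rw [h₁, h₂]
      exact ENNReal.ofReal_le_ofReal (pow_le_pow_left₀ hγ.le (hB y₁ hy₁ y₂ hy₂) 2)
    · simp [Set.indicator_of_notMem hω]
  rw [ENNReal.ofReal_div_of_pos (by positivity), ENNReal.le_div_iff_mul_le
    (Or.inl (by simp [hγ.ne'])) (Or.inl ENNReal.ofReal_ne_top), mul_comm]
  exact hle

/-- A point of a closed thickening need not have a point of the set within the exact radius. Both
radii are enlarged by `η / 2`, and `η` is arbitrary. -/
theorem le_norm_sub_of_mem_cthickening {d : ℕ} {S₁ S₂ : Set (Param d)} {r α β : ℝ} (hα : 0 < α)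
    (hβ : 0 < β) (hS : ∀ x₁ ∈ S₁, ∀ x₂ ∈ S₂, r ≤ ‖x₁ - x₂‖) {y₁ y₂ : Param d}
    (hy₁ : y₁ ∈ Metric.cthickening α S₁) (hy₂ : y₂ ∈ Metric.cthickening β S₂) :
    r - α - β ≤ ‖y₁ - y₂‖ := by
  refine le_of_forall_pos_le_add fun η hη => ?_
  obtain ⟨x₁, hx₁, h₁⟩ := Metric.mem_thickening_iff.1
    (Metric.cthickening_subset_thickening' (by positivity) (by linarith : α < α + η / 2) S₁ hy₁)
  obtain ⟨x₂, hx₂, h₂⟩ := Metric.mem_thickening_iff.1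
    (Metric.cthickening_subset_thickening' (by positivity) (by linarith : β < β + η / 2) S₂ hy₂)
  have h := hS x₁ hx₁ x₂ hx₂
  rw [← dist_eq_norm] at h ⊢
  have := dist_triangle4 x₁ y₁ y₂ x₂
  rw [dist_comm x₁ y₁] at this
  linarith

/-! ### Quantitative consequences of an implementation -/

namespace Implements

variable {n d : ℕ} {Ω : Type u} [MeasurableSpace Ω] {μ : Measure Ω}
  {X : Fin n → Ω → Option (Param d)} {N : Set (Fin n)} {M : SeqSGD.{v} d} {ε δ : ℝ}

theorem measurableSet_exists_mem (h : Implements μ X N M ε δ) (G : Set (Fin n))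
    {B : Set (Param d)} (hB : MeasurableSet B) :
    MeasurableSet {ω | ∃ i ∈ G, ∃ y ∈ B, X i ω = some y} := by
  have : {ω | ∃ i ∈ G, ∃ y ∈ B, X i ω = some y} =
      ⋃ i ∈ G, {ω | ∃ y ∈ B, X i ω = some y} := by
    ext ω
    simp
  rw [this]
  exact MeasurableSet.biUnion (Set.to_countable G) fun i _ => h.measurable i B hB

/-- `S` is arbitrary, so the points within `β` of it need not form a measurable set. The closed
thickening contains them and is closed, hence measurable. -/
theorem prob_near_le (h : Implements μ X N M ε δ) {G : Set (Fin n)} (hG : (G ∩ N).Nonempty)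
    {β : ℝ} (hβ : 0 < β) (S : Set (Param d)) :
    M.prob (M.near β S) ≤ μ {ω | ∃ i ∈ G, ∃ y ∈ Metric.cthickening β S, X i ω = some y} := by
  refine (h.preserves β S G hβ hG).trans (measure_mono ?_)
  rintro ω ⟨x, hx, i, hi, y, hy, hyx⟩
  exact ⟨i, hi, y, Metric.mem_cthickening_of_dist_le y x β S hx (by rwa [dist_eq_norm]), hy⟩

/-- Union bound over all `n ^ 2` ordered pairs of processes; this is the origin of the factor `n ^
2`. -/
theorem measure_exists_mem_mem_le (h : Implements μ X N M ε δ) {γ : ℝ} (hγ : 0 < γ)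
    {B₁ B₂ : Set (Param d)} (hB₁ : MeasurableSet B₁) (hB₂ : MeasurableSet B₂)
    (hB : ∀ y₁ ∈ B₁, ∀ y₂ ∈ B₂, γ ≤ ‖y₁ - y₂‖) (G₁ G₂ : Set (Fin n)) :
    μ ({ω | ∃ i ∈ G₁, ∃ y ∈ B₁, X i ω = some y} ∩ {ω | ∃ i ∈ G₂, ∃ y ∈ B₂, X i ω = some y}) ≤
      ENNReal.ofReal (δ * (n : ℝ) ^ 2 / γ ^ 2) := by
  calc
    _ ≤ μ (⋃ a ∈ (Finset.univ : Finset (Fin n × Fin n)),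
          ({ω | ∃ y ∈ B₁, X a.1 ω = some y} ∩ {ω | ∃ y ∈ B₂, X a.2 ω = some y})) := by
      refine measure_mono ?_
      rintro ω ⟨⟨i, -, hi⟩, j, -, hj⟩
      simp only [Finset.mem_univ, Set.iUnion_true, Set.mem_iUnion]
      exact ⟨(i, j), hi, hj⟩
    _ ≤ ∑ a : Fin n × Fin n,
          μ ({ω | ∃ y ∈ B₁, X a.1 ω = some y} ∩ {ω | ∃ y ∈ B₂, X a.2 ω = some y}) :=
      measure_biUnion_finset_le _ _
    _ ≤ ∑ _a : Fin n × Fin n, ENNReal.ofReal (δ / γ ^ 2) :=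
      Finset.sum_le_sum fun a _ => measure_mem_mem_le hγ hB (h.measurable _ _ hB₁)
        (h.measurable _ _ hB₂) (h.internal _ _)
    _ = ENNReal.ofReal (δ * (n : ℝ) ^ 2 / γ ^ 2) := by
      rw [Finset.sum_const, ← ENNReal.ofReal_nsmul]
      congr 1
      simp
      ring

end Implements

theorem SeqSGD.IsSplit.exists_ofReal_le {d : ℕ} {M : SeqSGD.{v} d} {γ p : ℝ}
    (h : M.IsSplit γ p) : ∃ (S₁ S₂ : Set (Param d)) (α β : ℝ), 0 < α ∧ 0 < β ∧
      (∀ y₁ ∈ Metric.cthickening α S₁, ∀ y₂ ∈ Metric.cthickening β S₂, γ ≤ ‖y₁ - y₂‖) ∧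
      ENNReal.ofReal p ≤ M.prob (M.near α S₁) * M.prob (M.near β S₂) := by
  obtain ⟨-, -, -, S₁, S₂, r, α, β, hα, hβ, hS, hr, hp⟩ := h
  refine ⟨S₁, S₂, α, β, hα, hβ, fun y₁ hy₁ y₂ hy₂ =>
    hr.trans (le_norm_sub_of_mem_cthickening hα hβ hS hy₁ hy₂), ?_⟩
  refine (ENNReal.ofReal_le_ofReal hp).trans ?_
  rw [ENNReal.ofReal_mul measureReal_nonneg]
  exact mul_le_mul' ENNReal.ofReal_toReal_le ENNReal.ofReal_toReal_le

/-! ### The partition argument -/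

namespace ClusterAlg

variable {n m d : ℕ} (A : ClusterAlg.{u} n m d) (cluster : Fin n → Fin m)

/-- Two groups of clusters that run on their own produce, with the same joint probability, the
same outputs in a common execution without communication between the groups, the beginnings of
which are the finite lists of events considered here. -/
theorem measure_mul_measure_le_of_tracked {C₁ C₂ : Set (Fin m)} (hC : Disjoint C₁ C₂)
    {σ₁ σ₂ : Schedule n} (hσ₁ : ∀ t, cluster (σ₁ t).proc ∈ C₁)
    (hσ₂ : ∀ t, cluster (σ₂ t).proc ∈ C₂) {B₁ B₂ : Set (Param d)}
    (hE₁ : MeasurableSet {ω | ∃ i ∈ cluster ⁻¹' C₁, ∃ y ∈ B₁, A.output cluster σ₁ i ω = some y})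
    (hE₂ : MeasurableSet {ω | ∃ i ∈ cluster ⁻¹' C₂, ∃ y ∈ B₂, A.output cluster σ₂ i ω = some y})
    {b : ℝ≥0∞} (hb : ∀ L : List (Event n), A.prob
      ({ω | ∃ i ∈ cluster ⁻¹' C₁, ∃ y ∈ B₁, (A.tracked cluster ω L).2 i = some y} ∩
        {ω | ∃ i ∈ cluster ⁻¹' C₂, ∃ y ∈ B₂, (A.tracked cluster ω L).2 i = some y}) ≤ b) :
    A.prob {ω | ∃ i ∈ cluster ⁻¹' C₁, ∃ y ∈ B₁, A.output cluster σ₁ i ω = some y} *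
      A.prob {ω | ∃ i ∈ cluster ⁻¹' C₂, ∃ y ∈ B₂, A.output cluster σ₂ i ω = some y} ≤ b := by
  rw [prob, ← infinitePi_inter_eq_mul _
    (hC.preimage fun a : Fin n × ℕ => cluster a.1) hE₁ hE₂ ?_ ?_]
  -- The times of the outputs depend on the coins and need not be bounded, hence the increasing
  -- union over `t`. Continuity from below along a monotone sequence requires no measurability of
  -- the `F t`.
  · let F : ℕ → Set A.Coins := fun t =>
      {ω | ∃ i ∈ cluster ⁻¹' C₁, ∃ y ∈ B₁, (A.tracked cluster ω (σ₁.initial t)).2 i = some y} ∩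
        {ω | ∃ i ∈ cluster ⁻¹' C₂, ∃ y ∈ B₂, (A.tracked cluster ω (σ₂.initial t)).2 i = some y}
    have hF : Monotone F := by
      rintro s t hst ω ⟨⟨i, hi, y, hy, h⟩, j, hj, z, hz, h'⟩
      exact ⟨⟨i, hi, y, hy, A.tracked_initial_mono cluster hst h⟩,
        j, hj, z, hz, A.tracked_initial_mono cluster hst h'⟩
    refine (measure_mono (t := ⋃ t, F t) ?_).trans ?_
    · rintro ω ⟨⟨i, hi, y, hy, h⟩, j, hj, z, hz, h'⟩
      obtain ⟨s, hs⟩ := (A.output_eq_some_iff cluster).1 h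
      obtain ⟨t, ht⟩ := (A.output_eq_some_iff cluster).1 h'
      exact Set.mem_iUnion.2 ⟨max s t,
        ⟨i, hi, y, hy, A.tracked_initial_mono cluster (le_max_left s t) hs⟩,
        j, hj, z, hz, A.tracked_initial_mono cluster (le_max_right s t) ht⟩
    · rw [hF.measure_iUnion]
      refine iSup_le fun t => le_trans (measure_mono ?_)
        (hb (internalPart cluster C₁ (σ₁.initial t) ++ internalPart cluster C₂ (σ₂.initial t)))
      have h₁ : ∀ e ∈ σ₁.initial t, cluster e.proc ∈ C₁ := fun e he => by
        obtain ⟨s, rfl⟩ := Schedule.mem_initial he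
        exact hσ₁ s
      have h₂ : ∀ e ∈ σ₂.initial t, cluster e.proc ∈ C₂ := fun e he => by
        obtain ⟨s, rfl⟩ := Schedule.mem_initial he
        exact hσ₂ s
      rintro ω ⟨⟨i, hi, y, hy, h⟩, j, hj, z, hz, h'⟩
      refine ⟨⟨i, hi, y, hy, ?_⟩, j, hj, z, hz, ?_⟩
      · rwa [A.tracked_internalPart_append_left cluster hC ω _ h₁ hi]
      · rwa [A.tracked_internalPart_append_right cluster hC ω _ h₂ hj]
  · intro ω ω' h
    simp only [Set.mem_ofPred_eq, A.output_congr_coins cluster fun t k => h ((σ₁ t).proc, k) (hσ₁ t)]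
  · intro ω ω' h
    simp only [Set.mem_ofPred_eq, A.output_congr_coins cluster fun t k => h ((σ₂ t).proc, k) (hσ₂ t)]

/-- A lower bound for the error of internal convergence: if two disjoint groups of clusters
converge on their own, and any finite execution can be continued so that the outputs of both groups
count, then the split probability is small. -/
theorem split_le {M : SeqSGD.{v} d} {ε δ γ p : ℝ} (hδ : 0 < δ) (hsplit : M.IsSplit γ p)
    {X : Schedule n → Fin n → A.Coins → Option (Param d)}
    (hX : ∀ σ, ∀ i ∈ σ.survivors, X σ i = A.output cluster σ i)
    {C₁ C₂ : Set (Fin m)} (hC : Disjoint C₁ C₂) (h₁ : (cluster ⁻¹' C₁).Nonempty)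
    (h₂ : (cluster ⁻¹' C₂).Nonempty)
    (hI₁ : ∀ σ, σ.ThoroughOn (cluster ⁻¹' C₁) → Implements A.prob (X σ) σ.survivors M ε δ)
    (hI₂ : ∀ σ, σ.ThoroughOn (cluster ⁻¹' C₂) → Implements A.prob (X σ) σ.survivors M ε δ)
    (hI : ∀ L : List (Event n), ∃ σ : Schedule n, σ.initial L.length = L ∧
      (∀ i ∈ cluster ⁻¹' C₁ ∪ cluster ⁻¹' C₂, X σ i = A.output cluster σ i) ∧
      Implements A.prob (X σ) σ.survivors M ε δ) :
    p ≤ δ * (n : ℝ) ^ 2 / γ ^ 2 := by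
  have hγ : 0 < γ := hsplit.1
  obtain ⟨S₁, S₂, α, β, hα, hβ, hdist, hp⟩ := hsplit.exists_ofReal_le
  have alone : ∀ {C : Set (Fin m)} {β : ℝ} (S : Set (Param d)), 0 < β →
      (cluster ⁻¹' C).Nonempty →
      (∀ σ, σ.ThoroughOn (cluster ⁻¹' C) → Implements A.prob (X σ) σ.survivors M ε δ) →
      ∃ σ : Schedule n, (∀ t, cluster (σ t).proc ∈ C) ∧
        MeasurableSet {ω | ∃ i ∈ cluster ⁻¹' C, ∃ y ∈ Metric.cthickening β S,
          A.output cluster σ i ω = some y} ∧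
        M.prob (M.near β S) ≤ A.prob {ω | ∃ i ∈ cluster ⁻¹' C, ∃ y ∈ Metric.cthickening β S,
          A.output cluster σ i ω = some y} := by
    intro C β S hβ hne hI
    obtain ⟨σ, hσ, hσC⟩ := Schedule.exists_thoroughOn hne
    have hout : {ω | ∃ i ∈ cluster ⁻¹' C, ∃ y ∈ Metric.cthickening β S,
          A.output cluster σ i ω = some y} =
        {ω | ∃ i ∈ cluster ⁻¹' C, ∃ y ∈ Metric.cthickening β S, X σ i ω = some y} := by
      ext ω
      refine exists_congr fun i => and_congr_right fun hi => ?_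
      rw [hX σ i (hσ.survivors_eq ▸ hi)]
    refine ⟨σ, hσC, ?_⟩
    rw [hout]
    exact ⟨(hI σ hσ).measurableSet_exists_mem _ Metric.isClosed_cthickening.measurableSet,
      (hI σ hσ).prob_near_le (by rwa [hσ.survivors_eq, Set.inter_self]) hβ S⟩
  obtain ⟨σ₁, hσ₁, hm₁, hp₁⟩ := alone S₁ hα h₁ hI₁
  obtain ⟨σ₂, hσ₂, hm₂, hp₂⟩ := alone S₂ hβ h₂ hI₂
  -- The continuation `σ` may depend on the list `L`, since the bound that it yields does not.
  have hle := A.measure_mul_measure_le_of_tracked cluster hC hσ₁ hσ₂ hm₁ hm₂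
    (b := ENNReal.ofReal (δ * (n : ℝ) ^ 2 / γ ^ 2)) fun L => by
      obtain ⟨σ, hL, hout, himp⟩ := hI L
      refine (measure_mono ?_).trans (himp.measure_exists_mem_mem_le hγ
        Metric.isClosed_cthickening.measurableSet Metric.isClosed_cthickening.measurableSet
        hdist (cluster ⁻¹' C₁) (cluster ⁻¹' C₂))
      rintro ω ⟨⟨i, hi, y, hy, h⟩, j, hj, z, hz, h'⟩
      refine ⟨⟨i, hi, y, hy, ?_⟩, j, hj, z, hz, ?_⟩
      · rw [hout i (Or.inl hi)]
        exact A.output_eq_some_of_tracked cluster hL h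
      · rw [hout j (Or.inr hj)]
        exact A.output_eq_some_of_tracked cluster hL h'
  exact (ENNReal.ofReal_le_ofReal_iff (by positivity)).1
    (hp.trans ((mul_le_mul' hp₁ hp₂).trans hle))

end ClusterAlg

/-! ### The two choices of groups -/

theorem mainTheorem4 {n m d : ℕ} (hm : 2 ≤ m)
    (cluster : Fin n → Fin m) (hcluster : Function.Surjective cluster)
    (M : SeqSGD.{v} d) (L s : ℝ) (hM : M.Regular L s)
    (ε δ γ p : ℝ) (hε : 0 < ε) (hδ : 0 < δ)
    (hsplit : M.IsSplit γ p) (hp : δ * (n : ℝ) ^ 2 / γ ^ 2 < p) (hγ : Real.sqrt δ * n ≤ γ) :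
    (¬ ∃ A : ClusterAlg.{u} n m d, ∀ σ : Schedule n, σ.Fair →
        (cluster '' σ.survivors).ncard ≤ m / 2 →
        Implements A.prob (A.output cluster σ) σ.survivors M ε δ) ∧
    (¬ ∃ A : ClusterAlg.{u} n m d, ∀ σ : Schedule n, σ.Fair →
        m / 2 ≤ (cluster '' σ.survivors).ncard →
        Implements A.prob (A.survivorOutput cluster σ) σ.survivors M ε δ) := by
  have himage : ∀ {σ : Schedule n} {C : Set (Fin m)}, σ.ThoroughOn (cluster ⁻¹' C) →
      cluster '' σ.survivors = C := fun {σ C} hσ => by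
    rw [hσ.survivors_eq, Set.image_preimage_eq C hcluster]
  constructor
  · rintro ⟨A, hA⟩
    have hsingle : ∀ (q : Fin m) (σ : Schedule n), σ.ThoroughOn (cluster ⁻¹' {q}) →
        Implements A.prob (A.output cluster σ) σ.survivors M ε δ := fun q σ hσ =>
      hA σ hσ.fair (by rw [himage hσ, Set.ncard_singleton]; omega)
    have hne : ∀ q : Fin m, (cluster ⁻¹' {q}).Nonempty := fun q =>
      (Set.singleton_nonempty q).preimage hcluster
    have hne₀₁ : (⟨0, by omega⟩ : Fin m) ≠ ⟨1, by omega⟩ := by simp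
    refine absurd hp (not_lt.2 (A.split_le cluster hδ hsplit (X := A.output cluster)
      (fun _ _ _ => rfl) (Set.disjoint_singleton.2 hne₀₁)
      (hne _) (hne _) (hsingle _) (hsingle _) fun L => ?_))
    -- After `L` only cluster `0` survives, so the bound on surviving clusters holds. Cluster `1`
    -- crashes, but its earlier outputs still count.
    obtain ⟨σ, hσ, -⟩ := Schedule.exists_thoroughOn (hne ⟨0, by omega⟩)
    exact ⟨.after L σ, Schedule.initial_after L σ, fun _ _ => rfl, hsingle _ _ (hσ.after L)⟩
  · rintro ⟨A, hA⟩
    -- A set of `m / 2` clusters and its complement, of size `m - m / 2 ≥ m / 2`: each may survive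
    -- alone, and `2 ≤ m` makes both nonempty.
    obtain ⟨C, -, hCcard⟩ := Finset.exists_subset_card_eq
      (s := (Finset.univ : Finset (Fin m))) (n := m / 2) (by simp; omega)
    have hC₁ : (C : Set (Fin m)).ncard = m / 2 := by rw [Set.ncard_coe_finset, hCcard]
    have hC₂ : (C : Set (Fin m))ᶜ.ncard = m - m / 2 := by
      rw [Set.ncard_compl, hC₁, Nat.card_fin]
    have hlarge : ∀ {C : Set (Fin m)}, m / 2 ≤ C.ncard → ∀ σ : Schedule n,
        σ.ThoroughOn (cluster ⁻¹' C) →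
        Implements A.prob (A.survivorOutput cluster σ) σ.survivors M ε δ := fun hC σ hσ =>
      hA σ hσ.fair (by rwa [himage hσ])
    have hne : ∀ {C : Set (Fin m)}, m / 2 ≤ C.ncard → (cluster ⁻¹' C).Nonempty := fun hC =>
      (Set.nonempty_of_ncard_ne_zero (by omega)).preimage hcluster
    have hout : ∀ (σ : Schedule n), ∀ i ∈ σ.survivors,
        A.survivorOutput cluster σ i = A.output cluster σ i := fun σ i hi => by
      funext ω
      rw [ClusterAlg.survivorOutput, if_pos hi]
    have huniv : m / 2 ≤ (Set.univ : Set (Fin m)).ncard := by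
      rw [Set.ncard_univ, Nat.card_fin]
      omega
    refine absurd hp (not_lt.2 (A.split_le cluster hδ hsplit (X := A.survivorOutput cluster) hout
      (C₁ := C) (C₂ := (C : Set (Fin m))ᶜ) disjoint_compl_right (hne hC₁.ge) (hne (by omega))
      (hlarge hC₁.ge) (hlarge (by omega)) fun L => ?_))
    -- Now crashes would erase outputs, so after `L` all processes go on and the delayed messages
    -- are delivered. This is too late to alter the first outputs made during `L`.
    obtain ⟨σ, hσ, -⟩ := Schedule.exists_thoroughOn (hne huniv)
    refine ⟨.after L σ, Schedule.initial_after L σ, fun i _ => hout _ i ?_,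
      hlarge huniv _ (hσ.after L)⟩
    rw [(hσ.after L).survivors_eq]
    exact Set.mem_univ _
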